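/- Let $H_n = 1 + \frac12 + \cdots + \frac1n$ be the harmonic numbers, $\gamma$ the Euler–Mascheroni constant, and $\Gamma$ the gamma function. Let $G = \sum_{n=0}^\infty \frac{(-1)^n}{(2n+1)^2}$ be Catalan's constant, $\varpi = 2\int_0^1 \frac{dt}{\sqrt{1-t^4}}$ the lemniscate constant, $\kappa = \sum_{n=1}^\infty \frac{\sin(n\pi/3)}{n^2}$ Gieseking's constant, and $$A = \lim_{n\to\infty} \frac{\prod_{k=1}^n k^k}{n^{n^2/2+n/2+1/12}\, e^{-n^2/4}}$$ the Glaisher–Kinkelin constant. Then the following two series converge (as limits of their partial sums) to the stated values: (i) $$\sum_{n = 1}^\infty (-1)^n n \left(H_n - \log\left( n - \frac{1}{2}\right) - \gamma - \frac{1}{n} \right) = \frac{\gamma + 1}{4} -\frac{G}{\pi } - \frac{1}{4}\log \left(\frac{\varpi^2}{\pi}\right);$$ (ii) $$\sum_{n = 1}^\infty (-1)^n n \left(H_n - \log\left( n - \frac{1}{3}\right) - \gamma - \frac{5}{6n} \right) = \frac{\gamma + 1}{4} - \frac{5\kappa}{6 \pi} - \log(A) + \frac{19}{36}\log(2) + \frac{\log(3)}{24}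 + \frac{1}{3}\log\left[\frac{\Gamma\left(\frac{5}{6}\right)}{\Gamma\left(\frac{1}{3}\right)} \right].$$ -/

import Mathlib

noncomputable section

/-- Catalan's constant `G = β(2) = ∑_{n ≥ 0} (-1)^n / (2n+1)^2`. -/
def catalanConstant : ℝ := ∑' n : ℕ, (-1 : ℝ) ^ n / (2 * (n : ℝ) + 1) ^ 2

/-- The lemniscate constant `ϖ = 2 ∫_0^1 dt / √(1 - t^4) = 2.622…`. -/
def lemniscateConstant : ℝ := 2 * ∫ t in (0 : ℝ)..1, 1 / √(1 - t ^ 4)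

/-- The Clausen function `Cl₂(θ) = ∑_{n ≥ 1} sin(nθ) / n^2`. -/
def clausenTwo (θ : ℝ) : ℝ := ∑' n : ℕ, Real.sin (((n : ℝ) + 1) * θ) / ((n : ℝ) + 1) ^ 2

/-- Gieseking's constant `κ = Cl₂(π/3) = 1.0149…`, the largest volume of a hyperbolic
tetrahedron. -/
def giesekingConstant : ℝ := clausenTwo (Real.pi / 3)

/-- The sequence `1^1 2^2 ⋯ n^n / (n^(n²/2 + n/2 + 1/12) e^(-n²/4))`. -/
def glaisherSeq (n : ℕ) : ℝ :=
  (∏ k ∈ Finset.Icc 1 n, (k : ℝ) ^ k) /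
    ((n : ℝ) ^ ((n : ℝ) ^ 2 / 2 + (n : ℝ) / 2 + 1 / 12) * Real.exp (-(n : ℝ) ^ 2 / 4))

/-- The Glaisher–Kinkelin constant `A = 1.2824…`, the limit of `glaisherSeq`
(which exists: `tendsto_glaisherSeq`). -/
def glaisherConstant : ℝ := Filter.limUnder Filter.atTop glaisherSeq

theorem glaisherSeq_pos {n : ℕ} (hn : 1 ≤ n) : 0 < glaisherSeq n := by
  have h0 : (0 : ℝ) < n := by exact_mod_cast hn
  unfold glaisherSeq
  refine div_pos (Finset.prod_pos fun k hk => ?_) (by positivity)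
  have : (0 : ℝ) < k := by exact_mod_cast (Finset.mem_Icc.1 hk).1
  positivity

theorem log_glaisherSeq_succ_sub {n : ℕ} (hn : 1 ≤ n) :
    Real.log (glaisherSeq (n + 1)) - Real.log (glaisherSeq n) =
      (2 * (n : ℝ) + 1) / 4 -
        ((n : ℝ) ^ 2 / 2 + (n : ℝ) / 2 + 1 / 12) * Real.log (1 + 1 / (n : ℝ)) := by
  have h0 : (0 : ℝ) < n := by exact_mod_cast hn
  have key : ∀ m : ℕ, 1 ≤ m → Real.log (glaisherSeq m) =
      Real.log (∏ k ∈ Finset.Icc 1 m, (k : ℝ) ^ k) -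
        (((m : ℝ) ^ 2 / 2 + (m : ℝ) / 2 + 1 / 12) * Real.log m + -(m : ℝ) ^ 2 / 4) := by
    intro m hm
    have hm0 : (0 : ℝ) < m := by exact_mod_cast hm
    have hp : (∏ k ∈ Finset.Icc 1 m, (k : ℝ) ^ k) ≠ 0 := by
      refine Finset.prod_ne_zero_iff.2 fun k hk => ?_
      have : (0 : ℝ) < k := by exact_mod_cast (Finset.mem_Icc.1 hk).1
      positivity
    unfold glaisherSeq
    rw [Real.log_div hp (by positivity), Real.log_mul (by positivity) (by positivity),
      Real.log_rpow hm0, Real.log_exp]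
  have hp : (∏ k ∈ Finset.Icc 1 n, (k : ℝ) ^ k) ≠ 0 := by
    refine Finset.prod_ne_zero_iff.2 fun k hk => ?_
    have : (0 : ℝ) < k := by exact_mod_cast (Finset.mem_Icc.1 hk).1
    positivity
  have h1 : (1 : ℝ) + 1 / n = (n + 1) / n := by field_simp
  rw [key _ hn, key _ (by omega), Finset.prod_Icc_succ_top (by omega),
    Real.log_mul hp (by positivity), Real.log_pow, h1, Real.log_div (by positivity) h0.ne']
  push_cast
  ring

theorem exists_tendsto_glaisherSeq : ∃ a, Filter.Tendsto glaisherSeq Filter.atTop (nhds a) := by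
  have hsum : Summable fun n : ℕ =>
      Real.log (glaisherSeq (n + 1)) - Real.log (glaisherSeq n) := by
    have hs : Summable fun n : ℕ => 4 * (1 / (n : ℝ) ^ 2) :=
      (Real.summable_one_div_nat_pow.2 (by norm_num)).mul_left 4
    refine Summable.of_norm_bounded_eventually_nat hs ?_
    filter_upwards [Filter.eventually_ge_atTop 2] with n hn
    have hn2 : (2 : ℝ) ≤ n := by exact_mod_cast hn
    have h0 : (0 : ℝ) < n := by linarith
    rw [log_glaisherSeq_succ_sub (by omega)]
    set u : ℝ := 1 / (n : ℝ) with hu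
    have hu0 : 0 < u := by positivity
    have hu2 : u ≤ 1 / 2 := one_div_le_one_div_of_le (by norm_num) hn2
    have hnu : (n : ℝ) = 1 / u := by rw [hu]; simp
    have hb := Real.abs_log_sub_add_sum_range_le (x := -u)
      (by rw [abs_neg, abs_of_pos hu0]; linarith) 3
    rw [abs_neg, abs_of_pos hu0, sub_neg_eq_add] at hb
    have hb2 : |Real.log (1 + u) - (u - u ^ 2 / 2 + u ^ 3 / 3)| ≤ 2 * u ^ 4 := by
      have e : (∑ i ∈ Finset.range 3, (-u) ^ (i + 1) / ((i : ℝ) + 1)) + Real.log (1 + u) =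
          Real.log (1 + u) - (u - u ^ 2 / 2 + u ^ 3 / 3) := by
        simp [Finset.sum_range_succ]; ring
      rw [e] at hb
      refine hb.trans ?_
      rw [div_le_iff₀ (by linarith)]
      have h4 : u ^ (3 + 1) = u ^ 4 := rfl
      rw [h4]
      nlinarith [mul_nonneg (pow_pos hu0 4).le (by linarith : (0 : ℝ) ≤ 1 - 2 * u)]
    set r := Real.log (1 + u) - (u - u ^ 2 / 2 + u ^ 3 / 3) with hr
    have hl : Real.log (1 + u) = r + (u - u ^ 2 / 2 + u ^ 3 / 3) := by rw [hr]; ring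
    have e2 : (2 * (n : ℝ) + 1) / 4 -
        ((n : ℝ) ^ 2 / 2 + (n : ℝ) / 2 + 1 / 12) * Real.log (1 + u) =
        -(u ^ 2 * (1 / 8 + u / 36)) -
          r * (1 / (2 * u ^ 2) + 1 / (2 * u) + 1 / 12) := by
      rw [hl, hnu]; field_simp; ring
    have e3 : 4 * (1 / (n : ℝ) ^ 2) = 4 * u ^ 2 := by rw [hu]; ring
    rw [e2, e3, Real.norm_eq_abs]
    have hc : 0 < 1 / (2 * u ^ 2) + 1 / (2 * u) + 1 / 12 := by positivity
    have e4 : 2 * u ^ 4 * (1 / (2 * u ^ 2) + 1 / (2 * u) + 1 / 12) =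
        u ^ 2 * (1 + u + u ^ 2 / 6) := by field_simp; ring
    have h5 : |r * (1 / (2 * u ^ 2) + 1 / (2 * u) + 1 / 12)| ≤ u ^ 2 * (1 + u + u ^ 2 / 6) := by
      rw [abs_mul, abs_of_pos hc, ← e4]
      exact mul_le_mul_of_nonneg_right hb2 hc.le
    have h6 : |-(u ^ 2 * (1 / 8 + u / 36))| = u ^ 2 * (1 / 8 + u / 36) := by
      rw [abs_neg, abs_of_pos (by positivity)]
    refine (abs_sub _ _).trans ?_
    rw [h6]
    have h7 : u ^ 2 * (1 / 8 + u / 36) + u ^ 2 * (1 + u + u ^ 2 / 6) ≤ u ^ 2 * 4 := by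
      rw [← mul_add]
      exact mul_le_mul_of_nonneg_left (by nlinarith) (by positivity)
    linarith
  have h2 := hsum.hasSum.tendsto_sum_nat
  simp only [Finset.sum_range_sub (fun n => Real.log (glaisherSeq n))] at h2
  have h3 := (h2.add_const (Real.log (glaisherSeq 0)))
  simp only [sub_add_cancel] at h3
  refine ⟨_, ((Real.continuous_exp.tendsto _).comp h3).congr' ?_⟩
  filter_upwards [Filter.eventually_ge_atTop 1] with n hn
  exact Real.exp_log (glaisherSeq_pos hn)

theorem tendsto_glaisherSeq :
    Filter.Tendsto glaisherSeq Filter.atTop (nhds glaisherConstant) :=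
  tendsto_nhds_limUnder exists_tendsto_glaisherSeq

end

open Filter Topology MeasureTheory

/-! ### Asymptotics of the harmonic numbers -/

/-! Both series are the case a = 1/2 or a = 1/3 of one with general term (-1)^n n (H_n - log(n - a)
- γ - (1/2 + a)/n). Since n (H_n - log n - γ) tends to 1/2 and -n log(1 - a/n) to a, the terms tend
to 0, and only partial sums of even length 2M matter. There the harmonic part has a closed form,
which leaves the asymptotics of ∑ (-1)^n n log(n - a).

Write n = (n - a) + a. The sums ∑ (-1)^n log(n - a) are governed by Euler's limit for Γ and give
log(Γ((1 - a)/2) / Γ(1 - a/2)). What remains is T_a(M) = ∑_{n ≤ 2M} (-1)^n (n - a) log(n - a).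

The symmetric combination T_a + T_{1-a} is, up to 2M log(2M), the integral over [0, a] of a partial
sum of the logarithm of a product for cot(πx/2). So it yields ∫_0^a log cot(πx/2) dx, which Fourier
expansion turns into (2/π) ∑ sin((2n+1)πa)/(2n+1)²
(`tendsto_alternating_sum_mul_log_add_reflection`, `integral_logCot`).

For a = 1/2 the two halves coincide and the sine series is Catalan's constant; the Γ quotient
becomes the lemniscate constant through B(1/4, 1/2). For a = 1/3 the difference T_{2/3} - T_{1/3} is
also needed. It comes from splitting T_0(3M) by residues modulo 3, where T_0 is known through the
Glaisher–Kinkelin constant (`tendsto_alternating_sum_thirds_sub`). Clausen duplication then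
identifies the sine series as 5κ/6. -/

theorem two_mul_log_le_sub_inv {y : ℝ} (hy : 1 ≤ y) : 2 * Real.log y ≤ y - y⁻¹ := by
  have h := Real.self_le_sinh_iff.2 (Real.log_nonneg hy)
  rw [Real.sinh_eq, Real.exp_neg, Real.exp_log (by linarith)] at h
  linarith

/-- The bound log(1 + x) ≥ 2x/(x + 2) at x = 1/(n + 1/2) has right side exactly 1/(n + 1), the
harmonic increment. With the monotone sequence below it traps H_n - γ between log(n + 1/2) and log n
+ 1/(2n), tightly enough to find the 1/(2n) term. -/
theorem antitone_harmonic_sub_log_add_half :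
    Antitone fun n : ℕ => (harmonic n : ℝ) - Real.log ((n : ℝ) + 1 / 2) := by
  refine antitone_nat_of_succ_le fun n => ?_
  have hn : (0 : ℝ) ≤ n := n.cast_nonneg
  have h := Real.le_log_one_add_of_nonneg (x := 1 / ((n : ℝ) + 1 / 2)) (by positivity)
  have e1 : 2 * (1 / ((n : ℝ) + 1 / 2)) / (1 / ((n : ℝ) + 1 / 2) + 2) = ((n : ℝ) + 1)⁻¹ := by
    field_simp; ring
  have e2 : 1 + 1 / ((n : ℝ) + 1 / 2) = ((n : ℝ) + 1 + 1 / 2) / ((n : ℝ) + 1 / 2) := by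
    field_simp; ring
  rw [e1, e2, Real.log_div (by positivity) (by positivity)] at h
  rw [harmonic_succ]
  push_cast
  linarith

theorem monotone_harmonic_sub_log_sub_half_inv :
    Monotone fun n : ℕ => (harmonic (n + 1) : ℝ) - Real.log ((n : ℝ) + 1) -
      1 / (2 * ((n : ℝ) + 1)) := by
  refine monotone_nat_of_le_succ fun n => ?_
  have hn : (0 : ℝ) ≤ n := n.cast_nonneg
  have h := two_mul_log_le_sub_inv (y := ((n : ℝ) + 1 + 1) / ((n : ℝ) + 1))
    (by rw [le_div_iff₀ (by positivity)]; linarith)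
  rw [Real.log_div (by positivity) (by positivity)] at h
  have e : ((n : ℝ) + 1 + 1) / ((n : ℝ) + 1) - (((n : ℝ) + 1 + 1) / ((n : ℝ) + 1))⁻¹ =
      2 * (((n : ℝ) + 1 + 1)⁻¹ + 1 / (2 * ((n : ℝ) + 1)) - 1 / (2 * ((n : ℝ) + 1 + 1))) := by
    field_simp; ring
  rw [e] at h
  rw [harmonic_succ (n + 1)]
  push_cast
  linarith

theorem log_add_half_le_harmonic_sub (n : ℕ) :
    Real.log ((n : ℝ) + 1 / 2) ≤ (harmonic n : ℝ) - Real.eulerMascheroniConstant := by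
  have hdiff : Tendsto (fun n : ℕ => Real.log ((n : ℝ) + 1 / 2) - Real.log n) atTop (𝓝 0) := by
    have h1 : Tendsto (fun n : ℕ => Real.log (1 + (1 / 2) / (n : ℝ))) atTop (𝓝 0) := by
      have := (tendsto_const_nhds (x := (1 : ℝ))).add (tendsto_const_div_atTop_nhds_zero_nat (1 / 2))
      simpa using this.log (by norm_num)
    refine h1.congr' ?_
    filter_upwards [eventually_ge_atTop 1] with n hn
    have h0 : (0 : ℝ) < n := by exact_mod_cast hn
    rw [← Real.log_div (by positivity) h0.ne']
    congr 1
    field_simp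
  have h := (Real.tendsto_harmonic_sub_log.sub hdiff)
  rw [sub_zero] at h
  have := antitone_harmonic_sub_log_add_half.le_of_tendsto (h.congr fun n => by ring) n
  linarith

theorem harmonic_sub_le_log_add_half_inv {n : ℕ} (hn : 1 ≤ n) :
    (harmonic n : ℝ) - Real.eulerMascheroniConstant ≤ Real.log n + 1 / (2 * (n : ℝ)) := by
  have h2 : Tendsto (fun n : ℕ => 1 / (2 * (n : ℝ))) atTop (𝓝 0) :=
    (tendsto_const_div_atTop_nhds_zero_nat (1 / 2)).congr fun n => by ring
  have h := (tendsto_add_atTop_iff_nat 1).2 (Real.tendsto_harmonic_sub_log.sub h2)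
  rw [sub_zero] at h
  obtain ⟨m, rfl⟩ : ∃ m, n = m + 1 := ⟨n - 1, by omega⟩
  have := monotone_harmonic_sub_log_sub_half_inv.ge_of_tendsto
    (h.congr fun n => by push_cast; ring) m
  push_cast
  linarith

theorem tendsto_nat_mul_log_one_add_div (t : ℝ) :
    Tendsto (fun n : ℕ => (n : ℝ) * Real.log (1 + t / n)) atTop (𝓝 t) :=
  (Real.tendsto_mul_log_one_add_div_atTop t).comp tendsto_natCast_atTop_atTop

theorem tendsto_nat_mul_harmonic_sub_log :
    Tendsto (fun n : ℕ => (n : ℝ) * ((harmonic n : ℝ) - Real.log n -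
      Real.eulerMascheroniConstant)) atTop (𝓝 (1 / 2)) := by
  refine tendsto_of_tendsto_of_tendsto_of_le_of_le' (tendsto_nat_mul_log_one_add_div (1 / 2))
    tendsto_const_nhds ?_ ?_
  · filter_upwards [eventually_ge_atTop 1] with n hn
    have h0 : (0 : ℝ) < n := by exact_mod_cast hn
    have h := log_add_half_le_harmonic_sub n
    have e : 1 + 1 / 2 / (n : ℝ) = ((n : ℝ) + 1 / 2) / n := by field_simp
    rw [e, Real.log_div (by positivity) h0.ne']
    exact mul_le_mul_of_nonneg_left (by linarith) h0.le
  · filter_upwards [eventually_ge_atTop 1] with n hn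
    have h0 : (0 : ℝ) < n := by exact_mod_cast hn
    have h := harmonic_sub_le_log_add_half_inv hn
    calc _ ≤ (n : ℝ) * (1 / (2 * (n : ℝ))) :=
          mul_le_mul_of_nonneg_left (by linarith) h0.le
      _ = 1 / 2 := by field_simp

/-! ### Alternating sums of even length -/

theorem sum_Icc_one_two_mul {R : Type*} [AddCommMonoid R] (f : ℕ → R) (M : ℕ) :
    ∑ n ∈ Finset.Icc 1 (2 * M), f n =
      ∑ j ∈ Finset.range M, (f (2 * j + 1) + f (2 * j + 2)) := by
  induction M with
  | zero => simp
  | succ M ih =>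
    rw [Finset.sum_range_succ, ← ih, show 2 * (M + 1) = 2 * M + 1 + 1 by ring,
      Finset.sum_Icc_succ_top (by omega), Finset.sum_Icc_succ_top (by omega), add_assoc]

theorem neg_one_pow_two_mul_add_one (j : ℕ) : (-1 : ℝ) ^ (2 * j + 1) = -1 := by
  rw [pow_succ, pow_mul]; simp

theorem neg_one_pow_two_mul_add_two (j : ℕ) : (-1 : ℝ) ^ (2 * j + 2) = 1 := by
  rw [pow_add, pow_mul]; simp

theorem sum_Icc_neg_one_pow_mul (f : ℕ → ℝ) (M : ℕ) :
    ∑ n ∈ Finset.Icc 1 (2 * M), (-1 : ℝ) ^ n * f n =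
      ∑ j ∈ Finset.range M, (f (2 * j + 2) - f (2 * j + 1)) := by
  rw [sum_Icc_one_two_mul]
  refine Finset.sum_congr rfl fun j _ => ?_
  rw [neg_one_pow_two_mul_add_one, neg_one_pow_two_mul_add_two]
  ring

/-- An odd partial sum differs from the preceding even one by its last term, which vanishes in the
limit. -/
theorem tendsto_sum_Icc_of_tendsto_even {f : ℕ → ℝ} {l : ℝ}
    (h : Tendsto (fun M : ℕ => ∑ n ∈ Finset.Icc 1 (2 * M), f n) atTop (𝓝 l))
    (hf : Tendsto f atTop (𝓝 0)) :
    Tendsto (fun N : ℕ => ∑ n ∈ Finset.Icc 1 N, f n) atTop (𝓝 l) := by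
  have h1 : Tendsto (fun N : ℕ => if N % 2 = 0 then 0 else f N) atTop (𝓝 0) := by
    refine squeeze_zero_norm (fun N => ?_) (tendsto_norm_zero.comp hf)
    split_ifs <;> simp
  have h2 := (h.comp (Nat.tendsto_div_const_atTop (n := 2) (by norm_num))).add h1
  rw [add_zero] at h2
  refine h2.congr fun N => ?_
  obtain ⟨k, rfl | rfl⟩ := Nat.even_or_odd' N
  · simp
  · have e : (2 * k + 1) / 2 = k := by omega
    have e' : ¬ (2 * k + 1) % 2 = 0 := by omega
    simp only [Function.comp_apply, e, e', if_false]
    rw [Finset.sum_Icc_succ_top (by omega)]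

theorem sum_Icc_neg_one_pow_mul_harmonic (M : ℕ) :
    ∑ n ∈ Finset.Icc 1 (2 * M), (-1 : ℝ) ^ n * ((n : ℝ) * (harmonic n : ℝ)) =
      (M : ℝ) * harmonic (2 * M) + harmonic (2 * M) / 2 - harmonic M / 4 := by
  rw [sum_Icc_neg_one_pow_mul]
  induction M with
  | zero => simp
  | succ M ih =>
    rw [Finset.sum_range_succ, ih, show 2 * (M + 1) = 2 * M + 1 + 1 by ring,
      harmonic_succ (2 * M + 1), harmonic_succ (2 * M), harmonic_succ M]
    push_cast
    field_simp
    ring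

theorem sum_Icc_neg_one_pow_mul_self (M : ℕ) :
    ∑ n ∈ Finset.Icc 1 (2 * M), (-1 : ℝ) ^ n * (n : ℝ) = M := by
  rw [sum_Icc_neg_one_pow_mul]
  push_cast
  simp only [add_sub_add_left_eq_sub, Finset.sum_const, Finset.card_range, nsmul_eq_mul]
  ring

/-- The harmonic series weighted by `(-1)^n n`, with `log (n - a)` subtracted, is governed by the
even partial sums of `(-1)^n n log (n - a)`. -/
theorem tendsto_alternating_harmonic_sub_log {a l : ℝ} (ha : a < 1)
    (h : Tendsto (fun M : ℕ => ∑ n ∈ Finset.Icc 1 (2 * M),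
        (-1 : ℝ) ^ n * ((n : ℝ) * Real.log ((n : ℝ) - a)) -
        (M : ℝ) * Real.log (2 * M) - Real.log M / 4) atTop (𝓝 l)) :
    Tendsto (fun N : ℕ => ∑ n ∈ Finset.Icc 1 N, (-1 : ℝ) ^ n * ((n : ℝ) *
        ((harmonic n : ℝ) - Real.log ((n : ℝ) - a) - Real.eulerMascheroniConstant -
          (1 / 2 + a) / n))) atTop
      (𝓝 ((Real.eulerMascheroniConstant + 1) / 4 + Real.log 2 / 2 - l)) := by
  have h2 : Tendsto (fun M : ℕ => 2 * M) atTop atTop :=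
    tendsto_id.const_mul_atTop' (by norm_num)
  refine tendsto_sum_Icc_of_tendsto_even ?_ ?_
  · have t1 := (tendsto_nat_mul_harmonic_sub_log.comp h2).div_const 2
    have t2 := (Real.tendsto_harmonic_sub_log.comp h2).div_const 2
    have t3 := Real.tendsto_harmonic_sub_log.div_const 4
    -- The constant log 2 / 2 is what remains of log(2M)/2 - log M/4 - log M/4 after the divergent
    -- logarithms cancel.
    have t := (((t1.add t2).sub t3).sub h).add_const (Real.log 2 / 2)
    have e : (1 / 2 / 2 + Real.eulerMascheroniConstant / 2 - Real.eulerMascheroniConstant / 4 - l +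
        Real.log 2 / 2) = (Real.eulerMascheroniConstant + 1) / 4 + Real.log 2 / 2 - l := by ring
    rw [e] at t
    refine t.congr' ?_
    filter_upwards [eventually_ge_atTop 1] with M hM
    have hM0 : (0 : ℝ) < M := by exact_mod_cast hM
    have hlog : Real.log (2 * (M : ℝ)) = Real.log 2 + Real.log M :=
      Real.log_mul (by norm_num) hM0.ne'
    have hone : ∑ n ∈ Finset.Icc 1 (2 * M), (-1 : ℝ) ^ n * (1 / 2 + a) = 0 := by
      rw [sum_Icc_neg_one_pow_mul]; simp
    have split : ∑ n ∈ Finset.Icc 1 (2 * M), (-1 : ℝ) ^ n * ((n : ℝ) *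
        ((harmonic n : ℝ) - Real.log ((n : ℝ) - a) - Real.eulerMascheroniConstant -
          (1 / 2 + a) / n)) =
        ∑ n ∈ Finset.Icc 1 (2 * M), (-1 : ℝ) ^ n * ((n : ℝ) * (harmonic n : ℝ)) -
        ∑ n ∈ Finset.Icc 1 (2 * M), (-1 : ℝ) ^ n * ((n : ℝ) * Real.log ((n : ℝ) - a)) -
        Real.eulerMascheroniConstant * ∑ n ∈ Finset.Icc 1 (2 * M), (-1 : ℝ) ^ n * (n : ℝ) -
        ∑ n ∈ Finset.Icc 1 (2 * M), (-1 : ℝ) ^ n * (1 / 2 + a) := by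
      rw [Finset.mul_sum, ← Finset.sum_sub_distrib, ← Finset.sum_sub_distrib,
        ← Finset.sum_sub_distrib]
      refine Finset.sum_congr rfl fun n hn => ?_
      have : (0 : ℝ) < n := by exact_mod_cast (Finset.mem_Icc.1 hn).1
      field_simp
    rw [split, hone, sum_Icc_neg_one_pow_mul_self, sum_Icc_neg_one_pow_mul_harmonic]
    simp only [Function.comp_apply]
    push_cast
    rw [hlog]
    ring
  -- The general term tends to 0 precisely because the subtracted constant is 1/2 + a: 1/2 from the
  -- harmonic numbers and a from the shifted logarithm.
  · have t := (tendsto_nat_mul_harmonic_sub_log.sub (tendsto_nat_mul_log_one_add_div (-a))).sub_const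
      (1 / 2 + a)
    have e : 1 / 2 - -a - (1 / 2 + a) = 0 := by ring
    rw [e] at t
    refine squeeze_zero_norm' ?_ (tendsto_norm_zero.comp t)
    filter_upwards [eventually_ge_atTop 1] with n hn
    have h1 : (1 : ℝ) ≤ n := by exact_mod_cast hn
    have h0 : (0 : ℝ) < n := by linarith
    have e : 1 + -a / (n : ℝ) = ((n : ℝ) - a) / n := by field_simp; ring
    rw [norm_mul, norm_pow, norm_neg, norm_one, one_pow, one_mul, Function.comp_apply, e,
      Real.log_div (by linarith) h0.ne']
    refine le_of_eq (congrArg _ ?_)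
    field_simp
    ring

/-! ### Ratios of gamma values -/

theorem tendsto_log_nat_add_sub_log_nat_add {s t : ℝ} (hs : 0 < s) (ht : 0 < t) :
    Tendsto (fun n : ℕ => Real.log ((n : ℝ) + t) - Real.log ((n : ℝ) + s)) atTop (𝓝 0) := by
  have key : ∀ s : ℝ, Tendsto (fun n : ℕ => Real.log (1 + s / n)) atTop (𝓝 0) := fun s => by
    have := (tendsto_const_nhds (x := (1 : ℝ))).add (tendsto_const_div_atTop_nhds_zero_nat s)
    simpa using this.log (by norm_num)
  have h := (key t).sub (key s)
  rw [sub_zero] at h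
  refine h.congr' ?_
  filter_upwards [eventually_ge_atTop 1] with n hn
  have h0 : (0 : ℝ) < n := by exact_mod_cast hn
  have e : ∀ s : ℝ, 1 + s / n = (n + s) / n := fun s => by field_simp
  rw [e, e, Real.log_div (by positivity) h0.ne', Real.log_div (by positivity) h0.ne']
  ring

theorem log_GammaSeq {s : ℝ} (hs : 0 < s) {n : ℕ} (hn : 1 ≤ n) :
    Real.log (Real.GammaSeq s n) = s * Real.log n + Real.log (n.factorial : ℝ) -
      ∑ j ∈ Finset.range (n + 1), Real.log ((j : ℝ) + s) := by
  have h0 : (0 : ℝ) < n := by exact_mod_cast hn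
  have hp : ∀ j ∈ Finset.range (n + 1), s + (j : ℝ) ≠ 0 := fun j _ => by positivity
  rw [Real.GammaSeq, Real.log_div (by positivity) (Finset.prod_ne_zero_iff.2 hp),
    Real.log_mul (by positivity) (by positivity), Real.log_rpow h0, Real.log_prod hp]
  simp only [add_comm]

/-- In the quotient of Euler's limits for Γ(s) and Γ(t) the factorials cancel. `Real.GammaSeq` has n
+ 1 factors, so the one with j = n is split off; its contribution log(n + t) - log(n + s) tends to
0. -/
theorem tendsto_sum_log_add_sub_log_add {s t : ℝ} (hs : 0 < s) (ht : 0 < t) :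
    Tendsto (fun M : ℕ => ∑ j ∈ Finset.range M, (Real.log ((j : ℝ) + t) - Real.log ((j : ℝ) + s)) -
      (t - s) * Real.log M) atTop (𝓝 (Real.log (Real.Gamma s / Real.Gamma t))) := by
  have hs' := Real.Gamma_pos_of_pos hs
  have ht' := Real.Gamma_pos_of_pos ht
  have h := (((Real.GammaSeq_tendsto_Gamma s).log hs'.ne').sub
    ((Real.GammaSeq_tendsto_Gamma t).log ht'.ne')).sub
    (tendsto_log_nat_add_sub_log_nat_add hs ht)
  rw [sub_zero, ← Real.log_div hs'.ne' ht'.ne'] at h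
  refine h.congr' ?_
  filter_upwards [eventually_ge_atTop 1] with n hn
  rw [log_GammaSeq hs hn, log_GammaSeq ht hn, Finset.sum_range_succ, Finset.sum_range_succ,
    Finset.sum_sub_distrib]
  ring

theorem tendsto_alternating_sum_log_sub {a : ℝ} (ha : a < 1) :
    Tendsto (fun M : ℕ => ∑ n ∈ Finset.Icc 1 (2 * M), (-1 : ℝ) ^ n * Real.log ((n : ℝ) - a) -
      Real.log M / 2) atTop
      (𝓝 (Real.log (Real.Gamma ((1 - a) / 2) / Real.Gamma (1 - a / 2)))) := by
  refine (tendsto_sum_log_add_sub_log_add (s := (1 - a) / 2) (t := 1 - a / 2) (by linarith)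
    (by linarith)).congr fun M => ?_
  rw [sum_Icc_neg_one_pow_mul]
  congr 1
  · refine Finset.sum_congr rfl fun j _ => ?_
    have hj : (0 : ℝ) ≤ j := j.cast_nonneg
    have e1 : ((2 * j + 2 : ℕ) : ℝ) - a = 2 * (j + (1 - a / 2)) := by push_cast; ring
    have e2 : ((2 * j + 1 : ℕ) : ℝ) - a = 2 * (j + (1 - a) / 2) := by push_cast; ring
    rw [e1, e2, Real.log_mul (by norm_num) (by linarith), Real.log_mul (by norm_num) (by linarith)]
    ring
  · ring

/-! ### The Glaisher–Kinkelin constant -/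

theorem log_one_add_le_cubic {u : ℝ} (hu : 0 ≤ u) :
    Real.log (1 + u) ≤ u - u ^ 2 / 2 + u ^ 3 / 3 := by
  have hd : ∀ x ∈ Set.Ici (0 : ℝ), HasDerivAt
      (fun x : ℝ => x - x ^ 2 / 2 + x ^ 3 / 3 - Real.log (1 + x)) (x ^ 3 / (1 + x)) x := by
    intro x hx
    have hx : 0 ≤ x := hx
    have h := ((((hasDerivAt_id x).sub (((hasDerivAt_id x).pow 2).div_const 2)).add
      (((hasDerivAt_id x).pow 3).div_const 3))).sub
      (((hasDerivAt_id x).const_add 1).log (by simp; linarith))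
    refine h.congr_deriv ?_
    simp only [id]
    field_simp
    ring
  have hmono : MonotoneOn (fun x : ℝ => x - x ^ 2 / 2 + x ^ 3 / 3 - Real.log (1 + x))
      (Set.Ici 0) := by
    refine monotoneOn_of_deriv_nonneg (convex_Ici 0)
      (fun x hx => (hd x hx).continuousAt.continuousWithinAt)
      (fun x hx => (hd x (interior_subset hx)).differentiableAt.differentiableWithinAt) ?_
    intro x hx
    have hx0 : 0 ≤ x := interior_subset hx
    rw [(hd x hx0).deriv]
    positivity
  have h := hmono (Set.mem_Ici.2 le_rfl) (Set.mem_Ici.2 hu) hu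
  simp at h
  linarith

/-- The logarithmic increment is at least -(1/8 + 1/(36m))/m², which the telescoping 1/(2m) - 1/(2(m
+ 1)) compensates. This keeps `glaisherSeq` away from 0, so that its limit has a meaningful
logarithm. -/
theorem monotone_log_glaisherSeq_sub :
    Monotone fun n : ℕ => Real.log (glaisherSeq (n + 1)) - 1 / (2 * ((n : ℝ) + 1)) := by
  refine monotone_nat_of_le_succ fun n => ?_
  have h := log_glaisherSeq_succ_sub (n := n + 1) (by omega)
  push_cast at h ⊢
  have hm : (0 : ℝ) < (n : ℝ) + 1 := by positivity
  have hm1 : (1 : ℝ) ≤ (n : ℝ) + 1 := by linarith [n.cast_nonneg (α := ℝ)]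
  set m : ℝ := (n : ℝ) + 1 with hmdef
  have hl := log_one_add_le_cubic (u := 1 / m) (by positivity)
  have hc : 0 ≤ m ^ 2 / 2 + m / 2 + 1 / 12 := by positivity
  have h1 := mul_le_mul_of_nonneg_left hl hc
  have e1 : (m ^ 2 / 2 + m / 2 + 1 / 12) * (1 / m - (1 / m) ^ 2 / 2 + (1 / m) ^ 3 / 3) =
      (2 * m + 1) / 4 + (1 / 8 + 1 / (36 * m)) / m ^ 2 := by field_simp; ring
  have e2 : (1 / 8 + 1 / (36 * m)) / m ^ 2 ≤ 1 / (2 * m) - 1 / (2 * (m + 1)) := by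
    have : 1 / (2 * m) - 1 / (2 * (m + 1)) - (1 / 8 + 1 / (36 * m)) / m ^ 2 =
        (27 * m ^ 2 - 11 * m - 2) / (72 * m ^ 3 * (m + 1)) := by field_simp; ring
    have h3 : 0 ≤ (27 * m ^ 2 - 11 * m - 2) / (72 * m ^ 3 * (m + 1)) :=
      div_nonneg (by nlinarith) (by positivity)
    linarith
  linarith

theorem glaisherConstant_pos : 0 < glaisherConstant := by
  have hlow : ∀ n : ℕ, Real.exp (Real.log (glaisherSeq 1) - 1 / 2) ≤ glaisherSeq (n + 1) := by
    intro n
    have h := monotone_log_glaisherSeq_sub (Nat.zero_le n)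
    have hp : (0 : ℝ) ≤ 1 / (2 * ((n : ℝ) + 1)) := by positivity
    rw [← Real.le_log_iff_exp_le (glaisherSeq_pos (by omega))]
    simp only [Nat.cast_zero, zero_add, mul_one] at h
    linarith
  exact (Real.exp_pos _).trans_le
    (ge_of_tendsto' ((tendsto_add_atTop_iff_nat 1).2 tendsto_glaisherSeq) hlow)

theorem log_glaisherSeq {m : ℕ} (hm : 1 ≤ m) :
    Real.log (glaisherSeq m) = ∑ k ∈ Finset.Icc 1 m, (k : ℝ) * Real.log k -
      (((m : ℝ) ^ 2 / 2 + (m : ℝ) / 2 + 1 / 12) * Real.log m - (m : ℝ) ^ 2 / 4) := by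
  have hm0 : (0 : ℝ) < m := by exact_mod_cast hm
  have hp : ∀ k ∈ Finset.Icc 1 m, (k : ℝ) ^ k ≠ 0 := fun k hk => by
    have : (0 : ℝ) < k := by exact_mod_cast (Finset.mem_Icc.1 hk).1
    positivity
  rw [glaisherSeq, Real.log_div (Finset.prod_ne_zero_iff.2 hp) (by positivity),
    Real.log_mul (by positivity) (by positivity), Real.log_rpow hm0, Real.log_exp,
    Real.log_prod hp]
  simp only [Real.log_pow]
  ring

/-- The alternating sum is twice the sum over even n minus the sum over all n, and an even term is
2k log 2 + 2k log k. -/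
theorem alternating_sum_mul_log_eq (K : ℕ) :
    ∑ n ∈ Finset.Icc 1 (2 * K), (-1 : ℝ) ^ n * ((n : ℝ) * Real.log n) =
      4 * ∑ k ∈ Finset.Icc 1 K, (k : ℝ) * Real.log k + 2 * Real.log 2 * ((K : ℝ) * (K + 1)) -
        ∑ k ∈ Finset.Icc 1 (2 * K), (k : ℝ) * Real.log k := by
  rw [sum_Icc_neg_one_pow_mul, sum_Icc_one_two_mul (fun k : ℕ => (k : ℝ) * Real.log k)]
  induction K with
  | zero => simp
  | succ K ih =>
    rw [Finset.sum_range_succ, ih, Finset.sum_range_succ, Finset.sum_Icc_succ_top (by omega)]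
    have e : ((2 * K + 2 : ℕ) : ℝ) = 2 * ((K + 1 : ℕ) : ℝ) := by push_cast; ring
    rw [e, Real.log_mul (by norm_num) (by positivity)]
    push_cast
    ring

theorem tendsto_alternating_sum_mul_log :
    Tendsto (fun K : ℕ => ∑ n ∈ Finset.Icc 1 (2 * K), (-1 : ℝ) ^ n * ((n : ℝ) * Real.log n) -
      (((K : ℝ) + 1 / 4) * Real.log K + ((K : ℝ) - 1 / 12) * Real.log 2)) atTop
      (𝓝 (3 * Real.log glaisherConstant)) := by
  have h2 : Tendsto (fun M : ℕ => 2 * M) atTop atTop :=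
    tendsto_id.const_mul_atTop' (by norm_num)
  have hA := tendsto_glaisherSeq.log glaisherConstant_pos.ne'
  have h := (hA.const_mul 4).sub (hA.comp h2)
  rw [show 4 * Real.log glaisherConstant - Real.log glaisherConstant =
    3 * Real.log glaisherConstant by ring] at h
  refine h.congr' ?_
  filter_upwards [eventually_ge_atTop 1] with K hK
  have hK0 : (0 : ℝ) < K := by exact_mod_cast hK
  rw [Function.comp_apply, log_glaisherSeq hK, log_glaisherSeq (by omega),
    alternating_sum_mul_log_eq]
  push_cast
  rw [Real.log_mul (by norm_num) hK0.ne']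
  ring

theorem three_mul_mul_log_three_mul (x : ℝ) :
    3 * x * Real.log (3 * x) = 3 * (x * Real.log x) + 3 * Real.log 3 * x := by
  rcases eq_or_ne x 0 with rfl | hx
  · simp
  · rw [Real.log_mul (by norm_num) hx]; ring

theorem alternating_sum_mul_log_three_mul (M : ℕ) :
    ∑ n ∈ Finset.Icc 1 (2 * (3 * M)), (-1 : ℝ) ^ n * ((n : ℝ) * Real.log n) =
      3 * (∑ n ∈ Finset.Icc 1 (2 * M), (-1 : ℝ) ^ n * ((n : ℝ) * Real.log n) +
        ∑ n ∈ Finset.Icc 1 (2 * M),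
          (-1 : ℝ) ^ n * (((n : ℝ) - 2 / 3) * Real.log ((n : ℝ) - 2 / 3)) -
        ∑ n ∈ Finset.Icc 1 (2 * M),
          (-1 : ℝ) ^ n * (((n : ℝ) - 1 / 3) * Real.log ((n : ℝ) - 1 / 3))) +
      3 * M * Real.log 3 := by
  simp only [sum_Icc_neg_one_pow_mul]
  induction M with
  | zero => simp
  | succ M ih =>
    rw [show 3 * (M + 1) = 3 * M + 1 + 1 + 1 by ring]
    simp only [Finset.sum_range_succ, ih]
    have e : ∀ (k : ℕ) (x : ℝ), (k : ℝ) = 3 * x → (k : ℝ) * Real.log k =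
        3 * (x * Real.log x) + 3 * Real.log 3 * x := fun k x hx => by
      rw [hx, three_mul_mul_log_three_mul]
    -- Passing from M to M + 1 adds the integers 6M + 1, …, 6M + 6. Each is three times an m, m -
    -- 1/3 or m - 2/3 with m = 2M + 1 or 2M + 2; since (-1)^(3m-1) = -(-1)^m, the class m - 1/3
    -- enters with a minus sign.
    rw [e (2 * (3 * M) + 2) ((2 * M + 1 : ℕ) - 1 / 3) (by push_cast; ring),
      e (2 * (3 * M) + 1) ((2 * M + 1 : ℕ) - 2 / 3) (by push_cast; ring),
      e (2 * (3 * M + 1) + 2) ((2 * M + 2 : ℕ) - 2 / 3) (by push_cast; ring),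
      e (2 * (3 * M + 1) + 1) ((2 * M + 1 : ℕ)) (by push_cast; ring),
      e (2 * (3 * M + 1 + 1) + 2) ((2 * M + 2 : ℕ)) (by push_cast; ring),
      e (2 * (3 * M + 1 + 1) + 1) ((2 * M + 2 : ℕ) - 1 / 3) (by push_cast; ring)]
    push_cast
    ring

theorem tendsto_alternating_sum_thirds_sub :
    Tendsto (fun M : ℕ => ∑ n ∈ Finset.Icc 1 (2 * M),
          (-1 : ℝ) ^ n * (((n : ℝ) - 2 / 3) * Real.log ((n : ℝ) - 2 / 3)) -
        ∑ n ∈ Finset.Icc 1 (2 * M),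
          (-1 : ℝ) ^ n * (((n : ℝ) - 1 / 3) * Real.log ((n : ℝ) - 1 / 3)) +
        Real.log M / 6) atTop
      (𝓝 (Real.log 3 / 12 + Real.log 2 / 18 - 2 * Real.log glaisherConstant)) := by
  have h3 : Tendsto (fun M : ℕ => 3 * M) atTop atTop :=
    tendsto_id.const_mul_atTop' (by norm_num)
  have h := (((tendsto_alternating_sum_mul_log.comp h3).div_const 3).sub
    tendsto_alternating_sum_mul_log).add_const (Real.log 3 / 12 + Real.log 2 / 18)
  rw [show 3 * Real.log glaisherConstant / 3 - 3 * Real.log glaisherConstant +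
    (Real.log 3 / 12 + Real.log 2 / 18) =
    Real.log 3 / 12 + Real.log 2 / 18 - 2 * Real.log glaisherConstant by ring] at h
  refine h.congr' ?_
  filter_upwards [eventually_ge_atTop 1] with M hM
  have hM0 : (0 : ℝ) < M := by exact_mod_cast hM
  rw [Function.comp_apply, alternating_sum_mul_log_three_mul]
  push_cast
  rw [Real.log_mul (by norm_num) hM0.ne']
  ring

/-! ### The lemniscate constant -/

theorem integral_rpow_mul_one_sub_rpow {u v : ℝ} (hu : 0 < u) (hv : 0 < v) :
    ∫ x in (0 : ℝ)..1, x ^ (u - 1) * (1 - x) ^ (v - 1) =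
      Real.Gamma u * Real.Gamma v / Real.Gamma (u + v) := by
  have h := ProbabilityTheory.beta_eq_betaIntegralReal u v hu hv
  rw [ProbabilityTheory.beta] at h
  rw [h, Complex.betaIntegral]
  have e : ∫ x in (0 : ℝ)..1, (x : ℂ) ^ ((u : ℂ) - 1) * (1 - (x : ℂ)) ^ ((v : ℂ) - 1) =
      ∫ x in (0 : ℝ)..1, ((x ^ (u - 1) * (1 - x) ^ (v - 1) : ℝ) : ℂ) := by
    refine intervalIntegral.integral_congr fun x hx => ?_
    rw [Set.uIcc_of_le zero_le_one] at hx
    rw [Complex.ofReal_mul, Complex.ofReal_cpow hx.1, Complex.ofReal_cpow (by linarith [hx.2])]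
    push_cast
    rfl
  rw [e, intervalIntegral.integral_ofReal, Complex.ofReal_re]

theorem integral_one_div_sqrt_one_sub_pow_four :
    ∫ t in (0 : ℝ)..1, 1 / √(1 - t ^ 4) =
      1 / 4 * ∫ x in (0 : ℝ)..1, x ^ ((1 / 4 : ℝ) - 1) * (1 - x) ^ ((1 / 2 : ℝ) - 1) := by
  -- The substitution x = t⁴ is available on (0, ∞); the indicator cuts both sides down to (0, 1).
  set g : ℝ → ℝ := (Set.Iio (1 : ℝ)).indicator
    fun x => x ^ ((1 / 4 : ℝ) - 1) * (1 - x) ^ ((1 / 2 : ℝ) - 1) with hg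
  have h := integral_comp_rpow_Ioi_of_pos (g := g) (p := 4) (by norm_num)
  have hset : Set.Ioi (0 : ℝ) ∩ Set.Iio 1 = Set.Ioo 0 1 := rfl
  have hr : ∫ y in Set.Ioi (0 : ℝ), g y =
      ∫ x in (0 : ℝ)..1, x ^ ((1 / 4 : ℝ) - 1) * (1 - x) ^ ((1 / 2 : ℝ) - 1) := by
    rw [hg, setIntegral_indicator measurableSet_Iio, hset,
      intervalIntegral.integral_of_le zero_le_one, integral_Ioc_eq_integral_Ioo]
  have hl : ∫ x in Set.Ioi (0 : ℝ), ((4 : ℝ) * x ^ ((4 : ℝ) - 1)) • g (x ^ (4 : ℝ)) =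
      ∫ x in Set.Ioi (0 : ℝ), (Set.Iio (1 : ℝ)).indicator (fun t => 4 * (1 / √(1 - t ^ 4))) x := by
    refine setIntegral_congr_fun measurableSet_Ioi fun x hx => ?_
    have hx0 : (0 : ℝ) < x := hx
    simp only [hg, Set.indicator, Set.mem_Iio]
    have e4 : x ^ (4 : ℝ) = x ^ 4 := by exact_mod_cast Real.rpow_natCast x 4
    by_cases h1 : x < 1
    · have hlt : x ^ 4 < 1 := pow_lt_one₀ hx0.le h1 (by norm_num)
      rw [if_pos h1, if_pos (by rw [e4]; exact hlt), ← Real.rpow_mul hx0.le, e4, smul_eq_mul]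
      have e1 : x ^ ((4 : ℝ) - 1) * x ^ ((4 : ℝ) * (1 / 4 - 1)) = 1 := by
        rw [← Real.rpow_add hx0]; norm_num
      have e2 : (1 - x ^ 4) ^ ((1 / 2 : ℝ) - 1) = 1 / √(1 - x ^ 4) := by
        rw [Real.sqrt_eq_rpow, one_div (_ ^ _), ← Real.rpow_neg (by linarith)]; norm_num
      rw [e2, ← mul_assoc, mul_assoc 4, e1, mul_one]
    · have hge : 1 ≤ x ^ 4 := one_le_pow₀ (not_lt.1 h1)
      rw [if_neg h1, if_neg (by rw [e4]; exact not_lt.2 hge), smul_zero]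
  rw [hl, hr, setIntegral_indicator measurableSet_Iio, hset, ← integral_Ioc_eq_integral_Ioo,
    ← intervalIntegral.integral_of_le zero_le_one, intervalIntegral.integral_const_mul] at h
  linarith

theorem lemniscateConstant_sq_div_pi :
    lemniscateConstant ^ 2 / Real.pi = ((Real.Gamma (1 / 4) / Real.Gamma (3 / 4)) / 2) ^ 2 := by
  rw [lemniscateConstant, integral_one_div_sqrt_one_sub_pow_four,
    integral_rpow_mul_one_sub_rpow (by norm_num) (by norm_num), Real.Gamma_one_half_eq,
    show (1 / 4 + 1 / 2 : ℝ) = 3 / 4 by norm_num]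
  have h : (√Real.pi) ^ 2 = Real.pi := Real.sq_sqrt Real.pi_pos.le
  have hp := Real.pi_pos
  have hG : 0 < Real.Gamma (3 / 4) := Real.Gamma_pos_of_pos (by norm_num)
  rw [div_eq_iff hp.ne']
  linear_combination (Real.Gamma (1 / 4) / Real.Gamma (3 / 4) / 2) ^ 2 * h

theorem log_lemniscateConstant_sq_div_pi :
    Real.log (lemniscateConstant ^ 2 / Real.pi) =
      2 * (Real.log (Real.Gamma (1 / 4) / Real.Gamma (3 / 4)) - Real.log 2) := by
  have h1 : 0 < Real.Gamma (1 / 4) := Real.Gamma_pos_of_pos (by norm_num)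
  have h3 : 0 < Real.Gamma (3 / 4) := Real.Gamma_pos_of_pos (by norm_num)
  rw [lemniscateConstant_sq_div_pi, Real.log_pow, Real.log_div (by positivity) (by norm_num)]
  norm_num

/-! ### The logarithm of the cotangent as a limit -/

/-- Since cos(πx/2) = sin(πx) / (2 sin(πx/2)), divide Euler's sine product at x with 2M factors by
the one at x/2 with M factors: the even-index factors cancel. -/
theorem tendsto_prod_one_sub_sq_div_odd_sq {x : ℝ} (h0 : 0 < x) (h1 : x < 1) :
    Tendsto (fun M : ℕ => ∏ j ∈ Finset.range M, (1 - x ^ 2 / (2 * (j : ℝ) + 1) ^ 2)) atTop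
      (𝓝 (Real.cos (Real.pi * x / 2))) := by
  have h2 : Tendsto (fun M : ℕ => 2 * M) atTop atTop :=
    tendsto_id.const_mul_atTop' (by norm_num)
  have hsin : 0 < Real.sin (Real.pi * (x / 2)) :=
    Real.sin_pos_of_pos_of_lt_pi (by positivity) (by nlinarith [Real.pi_pos])
  have h := (((Real.tendsto_euler_sin_prod x).comp h2).div (Real.tendsto_euler_sin_prod (x / 2))
    hsin.ne').div_const 2
  have e : Real.sin (Real.pi * x) / Real.sin (Real.pi * (x / 2)) / 2 =
      Real.cos (Real.pi * x / 2) := by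
    rw [show Real.pi * x = 2 * (Real.pi * (x / 2)) by ring, Real.sin_two_mul,
      show 2 * (Real.pi * (x / 2)) / 2 = Real.pi * (x / 2) by ring, mul_right_comm,
      mul_div_cancel_right₀ _ hsin.ne']
    ring
  rw [e] at h
  refine h.congr fun M => ?_
  have hprod : ∏ j ∈ Finset.range (2 * M), (1 - x ^ 2 / ((j : ℝ) + 1) ^ 2) =
      (∏ j ∈ Finset.range M, (1 - x ^ 2 / (2 * (j : ℝ) + 1) ^ 2)) *
        ∏ j ∈ Finset.range M, (1 - (x / 2) ^ 2 / ((j : ℝ) + 1) ^ 2) := by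
    induction M with
    | zero => simp
    | succ M ih =>
      rw [show 2 * (M + 1) = 2 * M + 1 + 1 by ring, Finset.prod_range_succ, Finset.prod_range_succ,
        ih, Finset.prod_range_succ, Finset.prod_range_succ]
      have e2 : x ^ 2 / (((2 * M + 1 : ℕ) : ℝ) + 1) ^ 2 = (x / 2) ^ 2 / ((M : ℝ) + 1) ^ 2 := by
        push_cast
        field_simp
        ring
      rw [e2]
      push_cast
      ring
  have hne : ∏ j ∈ Finset.range M, (1 - (x / 2) ^ 2 / ((j : ℝ) + 1) ^ 2) ≠ 0 := by
    refine Finset.prod_ne_zero_iff.2 fun j _ => ?_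
    have hj : (0 : ℝ) ≤ j := j.cast_nonneg
    have : (x / 2) ^ 2 / ((j : ℝ) + 1) ^ 2 < 1 := by
      rw [div_lt_one (by positivity)]
      nlinarith
    linarith
  simp only [Pi.div_apply, Function.comp_apply, hprod]
  rw [← mul_assoc, mul_div_mul_right _ _ hne]
  have := Real.pi_pos
  generalize ∏ j ∈ Finset.range M, (1 - x ^ 2 / (2 * (j : ℝ) + 1) ^ 2) = P
  field_simp

/-- The logarithm of `cot (π x / 2)`. -/
noncomputable def logCot (x : ℝ) : ℝ :=
  Real.log (Real.cos (Real.pi * x / 2)) - Real.log (Real.sin (Real.pi * x / 2))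

/-- The factors of a product for `cot (π x / 2)`, under the logarithm. -/
noncomputable def logCotTerm (j : ℕ) (x : ℝ) : ℝ :=
  Real.log (2 * j + 1 - x) + Real.log (2 * j + 1 + x) - Real.log (2 * j + x) -
    Real.log (2 * j + 2 - x)

/-- The claim amounts to (2j+1)² - x² ≥ (2j+1)² - (1-x)², hence the restriction x ≤ 1/2. Positivity
makes the partial sums increase to `logCot`, which then serves as the dominating function. -/
theorem logCotTerm_nonneg (j : ℕ) {x : ℝ} (h0 : 0 < x) (h1 : x ≤ 1 / 2) : 0 ≤ logCotTerm j x := by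
  have hj : (0 : ℝ) ≤ j := j.cast_nonneg
  have h := Real.log_le_log (x := (2 * j + x) * (2 * j + 2 - x))
    (y := (2 * j + 1 - x) * (2 * j + 1 + x)) (mul_pos (by linarith) (by linarith)) (by nlinarith)
  rw [Real.log_mul (by linarith) (by linarith), Real.log_mul (by linarith) (by linarith)] at h
  rw [logCotTerm]
  linarith

/-- Writing sin(πx/2) as cos(π(1 - x)/2) gives numerator and denominator of the cotangent products
with the same denominators (2j+1)², which cancel. -/
theorem sum_logCotTerm_eq (M : ℕ) {x : ℝ} (h0 : 0 < x) (h1 : x < 1) :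
    ∑ j ∈ Finset.range M, logCotTerm j x =
      Real.log (∏ j ∈ Finset.range M, (1 - x ^ 2 / (2 * (j : ℝ) + 1) ^ 2)) -
      Real.log (∏ j ∈ Finset.range M, (1 - (1 - x) ^ 2 / (2 * (j : ℝ) + 1) ^ 2)) := by
  have hpos : ∀ y : ℝ, 0 < y → y < 1 → ∀ j : ℕ, 0 < 1 - y ^ 2 / (2 * (j : ℝ) + 1) ^ 2 := by
    intro y hy0 hy1 j
    have hj : (0 : ℝ) ≤ j := j.cast_nonneg
    have : y ^ 2 / (2 * (j : ℝ) + 1) ^ 2 < 1 := by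
      rw [div_lt_one (by positivity)]
      nlinarith
    linarith
  rw [Real.log_prod fun j _ => (hpos x h0 h1 j).ne',
    Real.log_prod fun j _ => (hpos (1 - x) (by linarith) (by linarith) j).ne',
    ← Finset.sum_sub_distrib]
  refine Finset.sum_congr rfl fun j _ => ?_
  have hj : (0 : ℝ) ≤ j := j.cast_nonneg
  have e1 : 1 - x ^ 2 / (2 * (j : ℝ) + 1) ^ 2 =
      (2 * j + 1 - x) * (2 * j + 1 + x) / (2 * (j : ℝ) + 1) ^ 2 := by field_simp; ring
  have e2 : 1 - (1 - x) ^ 2 / (2 * (j : ℝ) + 1) ^ 2 =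
      (2 * j + x) * (2 * j + 2 - x) / (2 * (j : ℝ) + 1) ^ 2 := by field_simp; ring
  have p1 : 0 < 2 * j + 1 - x := by linarith
  have p2 : 0 < 2 * j + 2 - x := by linarith
  rw [e1, e2, Real.log_div (by positivity) (by positivity),
    Real.log_div (by positivity) (by positivity), Real.log_mul (by positivity) (by positivity),
    Real.log_mul (by positivity) (by positivity), logCotTerm]
  ring

theorem tendsto_sum_logCotTerm {x : ℝ} (h0 : 0 < x) (h1 : x < 1) :
    Tendsto (fun M : ℕ => ∑ j ∈ Finset.range M, logCotTerm j x) atTop (𝓝 (logCot x)) := by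
  have hpi := Real.pi_pos
  have hc : 0 < Real.cos (Real.pi * x / 2) :=
    Real.cos_pos_of_mem_Ioo ⟨by nlinarith, by nlinarith⟩
  have hs : 0 < Real.sin (Real.pi * x / 2) :=
    Real.sin_pos_of_pos_of_lt_pi (by positivity) (by nlinarith)
  have e : Real.cos (Real.pi * (1 - x) / 2) = Real.sin (Real.pi * x / 2) := by
    rw [show Real.pi * (1 - x) / 2 = Real.pi / 2 - Real.pi * x / 2 by ring, Real.cos_pi_div_two_sub]
  have hB := tendsto_prod_one_sub_sq_div_odd_sq (x := 1 - x) (by linarith) (by linarith)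
  rw [e] at hB
  refine (((tendsto_prod_one_sub_sq_div_odd_sq h0 h1).log hc.ne').sub (hB.log hs.ne')).congr
    fun M => ?_
  rw [sum_logCotTerm_eq M h0 h1]

theorem sum_logCotTerm_le (M : ℕ) {x : ℝ} (h0 : 0 < x) (h1 : x ≤ 1 / 2) :
    ∑ j ∈ Finset.range M, logCotTerm j x ≤ logCot x := by
  refine Monotone.ge_of_tendsto (f := fun M : ℕ => ∑ j ∈ Finset.range M, logCotTerm j x)
    (monotone_nat_of_le_succ fun n => ?_) (tendsto_sum_logCotTerm h0 (by linarith)) M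
  rw [Finset.sum_range_succ]
  linarith [logCotTerm_nonneg n h0 h1]

theorem intervalIntegrable_logCot (a b : ℝ) : IntervalIntegrable logCot volume a b := by
  have hc : ∀ x, Real.pi * x / 2 = Real.pi / 2 * x := fun x => by ring
  have hp : Real.pi / 2 ≠ 0 := by positivity
  have h1 := (intervalIntegrable_log_cos (a := Real.pi / 2 * a) (b := Real.pi / 2 * b)).comp_mul_left
    (c := Real.pi / 2)
  have h2 := (intervalIntegrable_log_sin (a := Real.pi / 2 * a) (b := Real.pi / 2 * b)).comp_mul_left
    (c := Real.pi / 2)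
  rw [mul_div_cancel_left₀ _ hp, mul_div_cancel_left₀ _ hp] at h1 h2
  refine (h1.sub h2).congr fun x _ => ?_
  simp only [logCot, hc, Function.comp_apply]

theorem measurable_sum_logCotTerm (M : ℕ) :
    Measurable fun x => ∑ j ∈ Finset.range M, logCotTerm j x := by
  unfold logCotTerm
  fun_prop

theorem tendsto_integral_sum_logCotTerm {a : ℝ} (h0 : 0 < a) (h1 : a ≤ 1 / 2) :
    Tendsto (fun M : ℕ => ∫ x in (0 : ℝ)..a, ∑ j ∈ Finset.range M, logCotTerm j x) atTop
      (𝓝 (∫ x in (0 : ℝ)..a, logCot x)) := by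
  refine intervalIntegral.tendsto_integral_filter_of_dominated_convergence logCot
    (Eventually.of_forall fun M => (measurable_sum_logCotTerm M).aestronglyMeasurable)
    (Eventually.of_forall fun M => Eventually.of_forall fun x hx => ?_)
    (intervalIntegrable_logCot 0 a) (Eventually.of_forall fun x hx => ?_)
  · rw [Set.uIoc_of_le h0.le] at hx
    have hx2 : x ≤ 1 / 2 := hx.2.trans h1
    rw [Real.norm_of_nonneg (Finset.sum_nonneg fun j _ => logCotTerm_nonneg j hx.1 hx2)]
    exact sum_logCotTerm_le M hx.1 hx2
  · rw [Set.uIoc_of_le h0.le] at hx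
    exact tendsto_sum_logCotTerm hx.1 (by linarith [hx.2])

/-! ### Alternating sums of `(n - a) log (n - a)` and their reflections -/

/-- An antiderivative of `logCotTerm j`. -/
noncomputable def logCotTermPrimitive (j : ℕ) (x : ℝ) : ℝ :=
  (2 * j + 2 - x) * Real.log (2 * j + 2 - x) + (2 * j + 1 + x) * Real.log (2 * j + 1 + x) -
    (2 * j + 1 - x) * Real.log (2 * j + 1 - x) - (2 * j + x) * Real.log (2 * j + x)

theorem continuous_logCotTermPrimitive (j : ℕ) : Continuous (logCotTermPrimitive j) := by
  have h := Real.continuous_mul_log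
  unfold logCotTermPrimitive
  exact (((h.comp (by fun_prop : Continuous fun x : ℝ => 2 * (j : ℝ) + 2 - x)).add
    (h.comp (by fun_prop : Continuous fun x : ℝ => 2 * (j : ℝ) + 1 + x))).sub
    (h.comp (by fun_prop : Continuous fun x : ℝ => 2 * (j : ℝ) + 1 - x))).sub
    (h.comp (by fun_prop : Continuous fun x : ℝ => 2 * (j : ℝ) + x))

theorem hasDerivAt_logCotTermPrimitive (j : ℕ) {x : ℝ} (h0 : 0 < x) (h1 : x < 1) :
    HasDerivAt (logCotTermPrimitive j) (logCotTerm j x) x := by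
  have hj : (0 : ℝ) ≤ j := j.cast_nonneg
  have hadd : ∀ c : ℝ, 0 < c + x → HasDerivAt (fun x => (c + x) * Real.log (c + x))
      (Real.log (c + x) + 1) x := fun c hc =>
    (Real.hasDerivAt_mul_log hc.ne').comp_const_add c x
  have hsub : ∀ c : ℝ, 0 < c - x → HasDerivAt (fun x => (c - x) * Real.log (c - x))
      (-(Real.log (c - x) + 1)) x := fun c hc =>
    (Real.hasDerivAt_mul_log hc.ne').comp_const_sub c x
  refine ((((hsub (2 * j + 2) (by linarith)).add (hadd (2 * j + 1) (by linarith))).sub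
    (hsub (2 * j + 1) (by linarith))).sub (hadd (2 * j) (by linarith))).congr_deriv ?_
  rw [logCotTerm]
  ring

theorem integral_sum_logCotTerm (M : ℕ) {a : ℝ} (h0 : 0 < a) (h1 : a ≤ 1 / 2) :
    ∫ x in (0 : ℝ)..a, ∑ j ∈ Finset.range M, logCotTerm j x =
      ∑ j ∈ Finset.range M, logCotTermPrimitive j a -
        ∑ j ∈ Finset.range M, logCotTermPrimitive j 0 := by
  -- The term j = 0 has a logarithmic singularity at 0, so the primitive is differentiated only in
  -- the open interval. Its continuity at 0 is that of y log y, and integrability comes from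
  -- domination by `logCot`.
  refine intervalIntegral.integral_eq_sub_of_hasDerivAt_of_le
    (f := fun x => ∑ j ∈ Finset.range M, logCotTermPrimitive j x) h0.le
    (continuous_finsetSum _ fun j _ => continuous_logCotTermPrimitive j).continuousOn
    (fun x hx => HasDerivAt.fun_sum fun j _ =>
      hasDerivAt_logCotTermPrimitive j hx.1 (by linarith [hx.2])) ?_
  refine (intervalIntegrable_logCot 0 a).mono_fun
    (measurable_sum_logCotTerm M).aestronglyMeasurable ?_
  refine (ae_restrict_iff' measurableSet_uIoc).2 (Eventually.of_forall fun x hx => ?_)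
  rw [Set.uIoc_of_le h0.le] at hx
  have hx2 : x ≤ 1 / 2 := hx.2.trans h1
  beta_reduce
  rw [Real.norm_of_nonneg (Finset.sum_nonneg fun j _ => logCotTerm_nonneg j hx.1 hx2)]
  exact (sum_logCotTerm_le M hx.1 hx2).trans (le_abs_self _)

theorem sum_logCotTermPrimitive_zero (M : ℕ) :
    ∑ j ∈ Finset.range M, logCotTermPrimitive j 0 = 2 * M * Real.log (2 * M) := by
  induction M with
  | zero => simp
  | succ M ih =>
    rw [Finset.sum_range_succ, ih, logCotTermPrimitive]
    push_cast
    rw [show (2 : ℝ) * (M + 1) = 2 * M + 2 by ring]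
    simp only [sub_zero, add_zero]
    ring

/-- The arguments 2j + 1 + a and 2j + a are n - (1 - a) for n = 2j + 2 and n = 2j + 1, which
produces the reflected sum. -/
theorem sum_logCotTermPrimitive (M : ℕ) (a : ℝ) :
    ∑ j ∈ Finset.range M, logCotTermPrimitive j a =
      ∑ n ∈ Finset.Icc 1 (2 * M), (-1 : ℝ) ^ n * (((n : ℝ) - a) * Real.log ((n : ℝ) - a)) +
      ∑ n ∈ Finset.Icc 1 (2 * M),
        (-1 : ℝ) ^ n * (((n : ℝ) - (1 - a)) * Real.log ((n : ℝ) - (1 - a))) := by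
  rw [sum_Icc_neg_one_pow_mul (fun n => ((n : ℝ) - a) * Real.log ((n : ℝ) - a)),
    sum_Icc_neg_one_pow_mul (fun n => ((n : ℝ) - (1 - a)) * Real.log ((n : ℝ) - (1 - a))),
    ← Finset.sum_add_distrib]
  refine Finset.sum_congr rfl fun j _ => ?_
  rw [logCotTermPrimitive]
  push_cast
  rw [show (2 : ℝ) * j + 2 - (1 - a) = 2 * j + 1 + a by ring,
    show (2 : ℝ) * j + 1 - (1 - a) = 2 * j + a by ring]
  ring

theorem tendsto_alternating_sum_mul_log_add_reflection {a : ℝ} (h0 : 0 < a) (h1 : a ≤ 1 / 2) :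
    Tendsto (fun M : ℕ =>
      ∑ n ∈ Finset.Icc 1 (2 * M), (-1 : ℝ) ^ n * (((n : ℝ) - a) * Real.log ((n : ℝ) - a)) +
      ∑ n ∈ Finset.Icc 1 (2 * M),
        (-1 : ℝ) ^ n * (((n : ℝ) - (1 - a)) * Real.log ((n : ℝ) - (1 - a))) -
      2 * M * Real.log (2 * M)) atTop (𝓝 (∫ x in (0 : ℝ)..a, logCot x)) := by
  refine (tendsto_integral_sum_logCotTerm h0 h1).congr fun M => ?_
  rw [integral_sum_logCotTerm M h0 h1, sum_logCotTermPrimitive_zero, sum_logCotTermPrimitive]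

/-! ### The integral of the logarithm of the cotangent as a sine series -/

/-- This is the arctangent series at -iw, multiplied by 2i. -/
theorem hasSum_log_one_add_div_one_sub {w : ℂ} (hw : ‖w‖ < 1) :
    HasSum (fun n : ℕ => 2 * w ^ (2 * n + 1) / ((2 * n + 1 : ℕ) : ℂ))
      (Complex.log ((1 + w) / (1 - w))) := by
  have h := (Complex.hasSum_arctan (z := -Complex.I * w) (by simpa using hw)).mul_left
    (2 * Complex.I)
  have hI := Complex.I_mul_I
  have e1 : -Complex.I * w * Complex.I = w := by linear_combination (-w) * hI
  have e2 : 2 * Complex.I * Complex.arctan (-Complex.I * w) =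
      Complex.log ((1 + w) / (1 - w)) := by
    rw [Complex.arctan, e1]
    linear_combination (-Complex.log ((1 + w) / (1 - w))) * hI
  rw [e2] at h
  refine h.congr_fun fun n => ?_
  have e3 : (-1 : ℂ) ^ n * (-Complex.I * w) ^ (2 * n + 1) = -Complex.I * w ^ (2 * n + 1) := by
    rw [mul_pow, pow_succ (-Complex.I), pow_mul (-Complex.I), neg_sq, Complex.I_sq, ← mul_assoc,
      ← mul_assoc, ← mul_pow]
    simp
  rw [e3]
  linear_combination (2 * w ^ (2 * n + 1) / ((2 * n + 1 : ℕ) : ℂ)) * hI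

/-- The real part of `log ((1 + w) / (1 - w))` at `w = r exp (i θ)`, as a function of `r` and
`c = cos θ`. -/
noncomputable def logRatio (r c : ℝ) : ℝ :=
  1 / 2 * Real.log ((1 + 2 * r * c + r ^ 2) / (1 - 2 * r * c + r ^ 2))

theorem hasSum_cos_odd_logRatio {r : ℝ} (hr0 : 0 ≤ r) (hr1 : r < 1) (θ : ℝ) :
    HasSum (fun n : ℕ => 2 * r ^ (2 * n + 1) * Real.cos ((2 * n + 1) * θ) / (2 * n + 1))
      (logRatio r (Real.cos θ)) := by
  set w : ℂ := r * Complex.exp (θ * Complex.I) with hw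
  have hnorm : ‖w‖ = r := by
    rw [hw, norm_mul, Complex.norm_exp_ofReal_mul_I, mul_one, Complex.norm_real,
      Real.norm_of_nonneg hr0]
  have h := Complex.hasSum_re (hasSum_log_one_add_div_one_sub (w := w) (by rw [hnorm]; exact hr1))
  have hre : w.re = r * Real.cos θ := by
    rw [hw, Complex.re_ofReal_mul, Complex.exp_ofReal_mul_I_re]
  have him : w.im = r * Real.sin θ := by
    rw [hw, Complex.im_ofReal_mul, Complex.exp_ofReal_mul_I_im]
  have hsc := Real.sin_sq_add_cos_sq θ
  have hp : Complex.normSq (1 + w) = 1 + 2 * r * Real.cos θ + r ^ 2 := by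
    rw [Complex.normSq_apply]
    simp only [Complex.add_re, Complex.one_re, Complex.add_im, Complex.one_im, hre, him]
    linear_combination r ^ 2 * hsc
  have hm : Complex.normSq (1 - w) = 1 - 2 * r * Real.cos θ + r ^ 2 := by
    rw [Complex.normSq_apply]
    simp only [Complex.sub_re, Complex.one_re, Complex.sub_im, Complex.one_im, hre, him]
    linear_combination r ^ 2 * hsc
  have hlog : (Complex.log ((1 + w) / (1 - w))).re = logRatio r (Real.cos θ) := by
    rw [Complex.log_re, logRatio, ← hp, ← hm, ← Complex.normSq_div, Complex.normSq_eq_norm_sq,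
      Real.log_pow]
    push_cast
    ring
  rw [hlog] at h
  refine h.congr_fun fun n => ?_
  have e : 2 * w ^ (2 * n + 1) / ((2 * n + 1 : ℕ) : ℂ) =
      ((2 * r ^ (2 * n + 1) / (2 * n + 1) : ℝ) : ℂ) *
        Complex.exp ((((2 * n + 1) * θ : ℝ) : ℂ) * Complex.I) := by
    rw [hw, mul_pow, ← Complex.exp_nat_mul]
    push_cast
    rw [mul_assoc (2 * (n : ℂ) + 1)]
    ring
  rw [e, Complex.re_ofReal_mul, Complex.exp_ofReal_mul_I_re]
  ring

theorem logCot_eq {x : ℝ} (h0 : 0 < x) (h1 : x < 1) :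
    logCot x = logRatio 1 (Real.cos (Real.pi * x)) := by
  have hpi := Real.pi_pos
  have hc : 0 < Real.cos (Real.pi * x / 2) :=
    Real.cos_pos_of_mem_Ioo ⟨by nlinarith, by nlinarith⟩
  have hs : 0 < Real.sin (Real.pi * x / 2) :=
    Real.sin_pos_of_pos_of_lt_pi (by positivity) (by nlinarith)
  have hsc := Real.sin_sq_add_cos_sq (Real.pi * x / 2)
  have e : Real.cos (Real.pi * x) = 2 * Real.cos (Real.pi * x / 2) ^ 2 - 1 := by
    rw [← Real.cos_two_mul]; congr 1; ring
  have e1 : 1 + 2 * 1 * Real.cos (Real.pi * x) + 1 ^ 2 = (2 * Real.cos (Real.pi * x / 2)) ^ 2 := by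
    rw [e]; ring
  have e2 : 1 - 2 * 1 * Real.cos (Real.pi * x) + 1 ^ 2 = (2 * Real.sin (Real.pi * x / 2)) ^ 2 := by
    rw [e]; linear_combination (-4) * hsc
  rw [logRatio, e1, e2, Real.log_div (by positivity) (by positivity), Real.log_pow, Real.log_pow,
    Real.log_mul (by norm_num) hc.ne', Real.log_mul (by norm_num) hs.ne', logCot]
  push_cast
  ring

theorem logRatio_nonneg {r c : ℝ} (hr0 : 0 ≤ r) (hr1 : r < 1) (hc0 : 0 ≤ c) (hc1 : c < 1) :
    0 ≤ logRatio r c := by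
  have hrc : 0 ≤ r * c := mul_nonneg hr0 hc0
  have hpos : 0 < 1 - 2 * r * c + r ^ 2 := by nlinarith
  refine mul_nonneg (by norm_num) (Real.log_nonneg ?_)
  rw [le_div_iff₀ hpos]
  linarith

/-- After cross-multiplication the difference of the two sides is 4c(1 - r)², nonnegative because c
≥ 0. For c = cos(πx) this again requires x ≤ 1/2. -/
theorem logRatio_le_logRatio_one {r c : ℝ} (hr0 : 0 ≤ r) (hr1 : r < 1) (hc0 : 0 ≤ c) (hc1 : c < 1) :
    logRatio r c ≤ logRatio 1 c := by
  have hrc : 0 ≤ r * c := mul_nonneg hr0 hc0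
  have hpos : 0 < 1 - 2 * r * c + r ^ 2 := by nlinarith
  have hpos' : 0 < 1 - 2 * 1 * c + 1 ^ 2 := by linarith
  refine mul_le_mul_of_nonneg_left (Real.log_le_log (div_pos (by positivity) hpos) ?_)
    (by norm_num)
  rw [div_le_div_iff₀ hpos hpos']
  nlinarith [mul_nonneg hc0 (sq_nonneg (1 - r))]

theorem tendsto_logRatio_one {c : ℝ} (hc0 : 0 ≤ c) (hc1 : c < 1) :
    Tendsto (fun r => logRatio r c) (𝓝[<] 1) (𝓝 (logRatio 1 c)) := by
  have h : ContinuousAt (fun r => logRatio r c) 1 := by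
    have hne : (1 : ℝ) - 2 * 1 * c + 1 ^ 2 ≠ 0 := by linarith
    unfold logRatio
    refine continuousAt_const.mul (ContinuousAt.log (ContinuousAt.div (by fun_prop) (by fun_prop)
      hne) (div_ne_zero (by positivity) hne))
  exact h.tendsto.mono_left nhdsWithin_le_nhds

theorem measurable_logRatio_cos (r : ℝ) :
    Measurable fun x => logRatio r (Real.cos (Real.pi * x)) := by
  unfold logRatio
  fun_prop

theorem cos_pi_mul_mem {x : ℝ} (h0 : 0 < x) (h1 : x ≤ 1 / 2) :
    0 ≤ Real.cos (Real.pi * x) ∧ Real.cos (Real.pi * x) < 1 := by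
  have hpi := Real.pi_pos
  refine ⟨Real.cos_nonneg_of_mem_Icc ⟨by nlinarith, by nlinarith⟩, ?_⟩
  have := Real.cos_lt_cos_of_nonneg_of_le_pi le_rfl (by nlinarith) (mul_pos hpi h0)
  rwa [Real.cos_zero] at this

theorem hasSum_integral_logRatio {r : ℝ} (hr0 : 0 ≤ r) (hr1 : r < 1) (a : ℝ) :
    HasSum (fun n : ℕ => 2 / Real.pi * (r ^ (2 * n + 1) *
        (Real.sin ((2 * n + 1) * (Real.pi * a)) / (2 * n + 1) ^ 2)))
      (∫ x in (0 : ℝ)..a, logRatio r (Real.cos (Real.pi * x))) := by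
  have hsum : Summable fun n : ℕ => 2 * r ^ n :=
    (summable_geometric_of_lt_one hr0 hr1).mul_left 2
  have h := intervalIntegral.hasSum_integral_of_dominated_convergence (μ := volume) (a := 0) (b := a)
    (F := fun (n : ℕ) x => 2 * r ^ (2 * n + 1) * Real.cos ((2 * n + 1) * (Real.pi * x)) / (2 * n + 1))
    (f := fun x => logRatio r (Real.cos (Real.pi * x))) (fun n _ => 2 * r ^ n)
    (fun n => (by fun_prop : Continuous fun x : ℝ =>
      2 * r ^ (2 * n + 1) * Real.cos ((2 * n + 1) * (Real.pi * x)) / (2 * n + 1)).aestronglyMeasurable)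
    (fun n => Eventually.of_forall fun x _ => ?_)
    (Eventually.of_forall fun x _ => hsum) intervalIntegrable_const
    (Eventually.of_forall fun x _ => hasSum_cos_odd_logRatio hr0 hr1 (Real.pi * x))
  · refine h.congr_fun fun n => ?_
    have hpi := Real.pi_pos
    have e : ∀ x : ℝ, 2 * r ^ (2 * n + 1) * Real.cos ((2 * n + 1) * (Real.pi * x)) / (2 * n + 1) =
        2 * r ^ (2 * n + 1) / (2 * n + 1) * Real.cos ((2 * n + 1) * Real.pi * x) := fun x => by
      rw [mul_assoc (2 * (n : ℝ) + 1)]; ring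
    simp only [e]
    rw [intervalIntegral.integral_const_mul, intervalIntegral.integral_comp_mul_left _ (by positivity),
      integral_cos, mul_zero, Real.sin_zero, sub_zero, smul_eq_mul, mul_assoc (2 * (n : ℝ) + 1)]
    field_simp
  · have hn : (1 : ℝ) ≤ 2 * n + 1 := by linarith [n.cast_nonneg (α := ℝ)]
    rw [norm_div, norm_mul, Real.norm_of_nonneg (by positivity : 0 ≤ 2 * r ^ (2 * n + 1)),
      Real.norm_of_nonneg (by positivity : (0 : ℝ) ≤ 2 * n + 1)]
    refine (div_le_self (by positivity) hn).trans ?_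
    calc 2 * r ^ (2 * n + 1) * ‖Real.cos ((2 * n + 1) * (Real.pi * x))‖
        ≤ 2 * r ^ (2 * n + 1) * 1 :=
          mul_le_mul_of_nonneg_left (Real.abs_cos_le_one _) (by positivity)
      _ ≤ 2 * r ^ n := by
          rw [mul_one]
          exact mul_le_mul_of_nonneg_left
            (pow_le_pow_of_le_one hr0 hr1.le (by omega)) (by norm_num)

theorem summable_one_div_odd_sq : Summable fun n : ℕ => 1 / (2 * (n : ℝ) + 1) ^ 2 := by
  have h : Summable fun n : ℕ => 1 / ((n : ℝ)) ^ 2 := Real.summable_one_div_nat_pow.2 (by norm_num)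
  have := h.comp_injective (i := fun n : ℕ => 2 * n + 1) (fun a b hab => by simpa using hab)
  simpa [Function.comp_def] using this

theorem norm_sin_div_le (θ : ℝ) (n : ℕ) :
    ‖Real.sin ((2 * n + 1) * θ) / (2 * (n : ℝ) + 1) ^ 2‖ ≤ 1 / (2 * (n : ℝ) + 1) ^ 2 := by
  rw [norm_div, Real.norm_of_nonneg (by positivity : (0 : ℝ) ≤ (2 * (n : ℝ) + 1) ^ 2)]
  exact div_le_div_of_nonneg_right (Real.abs_sin_le_one _) (by positivity)

/-- The cosine series of log cot is not absolutely convergent in general, so it is integrated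
termwise at radius r < 1 and then r tends to 1 from below. The integrals are dominated by `logCot`,
the sine series by ∑ 1/(2n+1)². -/
theorem integral_logCot {a : ℝ} (h0 : 0 < a) (h1 : a ≤ 1 / 2) :
    ∫ x in (0 : ℝ)..a, logCot x =
      2 / Real.pi * ∑' n : ℕ, Real.sin ((2 * n + 1) * (Real.pi * a)) / (2 * (n : ℝ) + 1) ^ 2 := by
  have hev : ∀ᶠ r : ℝ in 𝓝[<] 1, 0 ≤ r ∧ r < 1 := by
    filter_upwards [Ioo_mem_nhdsLT (zero_lt_one (α := ℝ))] with r hr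
    exact ⟨hr.1.le, hr.2⟩
  have hint : Tendsto (fun r => ∫ x in (0 : ℝ)..a, logRatio r (Real.cos (Real.pi * x))) (𝓝[<] 1)
      (𝓝 (∫ x in (0 : ℝ)..a, logCot x)) := by
    refine intervalIntegral.tendsto_integral_filter_of_dominated_convergence logCot
      (Eventually.of_forall fun r => (measurable_logRatio_cos r).aestronglyMeasurable) ?_
      (intervalIntegrable_logCot 0 a) (Eventually.of_forall fun x hx => ?_)
    · filter_upwards [hev] with r hr
      refine Eventually.of_forall fun x hx => ?_
      rw [Set.uIoc_of_le h0.le] at hx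
      obtain ⟨hc0, hc1⟩ := cos_pi_mul_mem hx.1 (hx.2.trans h1)
      rw [Real.norm_of_nonneg (logRatio_nonneg hr.1 hr.2 hc0 hc1),
        logCot_eq hx.1 (by linarith [hx.2])]
      exact logRatio_le_logRatio_one hr.1 hr.2 hc0 hc1
    · rw [Set.uIoc_of_le h0.le] at hx
      obtain ⟨hc0, hc1⟩ := cos_pi_mul_mem hx.1 (hx.2.trans h1)
      rw [logCot_eq hx.1 (by linarith [hx.2])]
      exact tendsto_logRatio_one hc0 hc1
  have hser : Tendsto (fun r : ℝ => ∑' n : ℕ, r ^ (2 * n + 1) *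
      (Real.sin ((2 * n + 1) * (Real.pi * a)) / (2 * (n : ℝ) + 1) ^ 2)) (𝓝[<] 1)
      (𝓝 (∑' n : ℕ, Real.sin ((2 * n + 1) * (Real.pi * a)) / (2 * (n : ℝ) + 1) ^ 2)) := by
    refine tendsto_tsum_of_dominated_convergence summable_one_div_odd_sq (fun n => ?_) ?_
    · have : Tendsto (fun r : ℝ => r ^ (2 * n + 1) *
          (Real.sin ((2 * n + 1) * (Real.pi * a)) / (2 * (n : ℝ) + 1) ^ 2)) (𝓝 1)
          (𝓝 (1 ^ (2 * n + 1) *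
          (Real.sin ((2 * n + 1) * (Real.pi * a)) / (2 * (n : ℝ) + 1) ^ 2))) :=
        Continuous.tendsto (by fun_prop) 1
      rw [one_pow, one_mul] at this
      exact this.mono_left nhdsWithin_le_nhds
    · filter_upwards [hev] with r hr n
      rw [norm_mul, Real.norm_of_nonneg (pow_nonneg hr.1 _)]
      exact (mul_le_of_le_one_left (norm_nonneg _) (pow_le_one₀ hr.1 hr.2.le)).trans
        (norm_sin_div_le _ n)
  refine tendsto_nhds_unique hint ((hser.const_mul (2 / Real.pi)).congr' ?_)
  filter_upwards [hev] with r hr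
  rw [← tsum_mul_left]
  exact (hasSum_integral_logRatio hr.1 hr.2 a).tsum_eq

/-! ### Catalan's and Gieseking's constants -/

theorem tsum_sin_odd_pi_half :
    ∑' n : ℕ, Real.sin ((2 * n + 1) * (Real.pi * (1 / 2))) / (2 * (n : ℝ) + 1) ^ 2 =
      catalanConstant := by
  refine tsum_congr fun n => ?_
  congr 1
  rw [show (2 * (n : ℝ) + 1) * (Real.pi * (1 / 2)) = Real.pi / 2 + n * Real.pi by ring,
    Real.sin_add_nat_mul_pi, Real.sin_pi_div_two, mul_one]

theorem summable_clausenTwo (θ : ℝ) :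
    Summable fun n : ℕ => Real.sin (((n : ℝ) + 1) * θ) / ((n : ℝ) + 1) ^ 2 := by
  have h : Summable fun n : ℕ => 1 / ((n : ℝ) + 1) ^ 2 := by
    have := (summable_nat_add_iff 1).2 (Real.summable_one_div_nat_pow.2 (by norm_num : 1 < 2))
    simpa using this
  refine h.of_norm_bounded fun n => ?_
  rw [norm_div, Real.norm_of_nonneg (by positivity : (0 : ℝ) ≤ ((n : ℝ) + 1) ^ 2)]
  exact div_le_div_of_nonneg_right (Real.abs_sin_le_one _) (by positivity)

theorem Summable.tsum_eq_even_add_odd {f : ℕ → ℝ} (hf : Summable f) :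
    ∑' k, f k = ∑' k, f (2 * k) + ∑' k, f (2 * k + 1) :=
  (tsum_even_add_odd (hf.comp_injective (mul_right_injective₀ (two_ne_zero' ℕ)))
    (hf.comp_injective ((add_left_injective 1).comp (mul_right_injective₀ (two_ne_zero' ℕ))))).symm

/-- Split by parity of the multiple of θ. Index k stands for the multiple k + 1, so even indices
carry the odd multiples and odd indices give the Clausen series at 2θ. -/
theorem clausenTwo_eq_odd_add (θ : ℝ) :
    clausenTwo θ = ∑' n : ℕ, Real.sin ((2 * n + 1) * θ) / (2 * (n : ℝ) + 1) ^ 2 +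
      1 / 4 * clausenTwo (2 * θ) := by
  have hodd : ∀ k : ℕ, Real.sin ((((2 * k + 1 : ℕ) : ℝ) + 1) * θ) / (((2 * k + 1 : ℕ) : ℝ) + 1) ^ 2 =
      1 / 4 * (Real.sin (((k : ℝ) + 1) * (2 * θ)) / ((k : ℝ) + 1) ^ 2) := fun k => by
    have e1 : (((2 * k + 1 : ℕ) : ℝ) + 1) * θ = ((k : ℝ) + 1) * (2 * θ) := by push_cast; ring
    have e2 : (((2 * k + 1 : ℕ) : ℝ) + 1) ^ 2 = 4 * ((k : ℝ) + 1) ^ 2 := by push_cast; ring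
    rw [e1, e2, div_mul_div_comm, one_mul]
  have heven : ∀ k : ℕ, Real.sin ((((2 * k : ℕ) : ℝ) + 1) * θ) / (((2 * k : ℕ) : ℝ) + 1) ^ 2 =
      Real.sin ((2 * k + 1) * θ) / (2 * (k : ℝ) + 1) ^ 2 := fun k => by
    rw [Nat.cast_mul, Nat.cast_two]
  rw [clausenTwo, (summable_clausenTwo θ).tsum_eq_even_add_odd, tsum_congr heven, tsum_congr hodd,
    tsum_mul_left, clausenTwo]

/-- Let O be the odd part at π/3, which equals the one at 2π/3. As Cl₂(4π/3) = -Cl₂(2π/3),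
duplication at 2π/3 gives Cl₂(2π/3) = 4O/5, and at π/3 it gives κ = O + O/5 = 6O/5. -/
theorem tsum_sin_odd_pi_third :
    ∑' n : ℕ, Real.sin ((2 * n + 1) * (Real.pi * (1 / 3))) / (2 * (n : ℝ) + 1) ^ 2 =
      5 / 6 * giesekingConstant := by
  have h1 := clausenTwo_eq_odd_add (Real.pi / 3)
  have h2 := clausenTwo_eq_odd_add (2 * (Real.pi / 3))
  have hodd : ∑' n : ℕ, Real.sin ((2 * n + 1) * (2 * (Real.pi / 3))) / (2 * (n : ℝ) + 1) ^ 2 =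
      ∑' n : ℕ, Real.sin ((2 * n + 1) * (Real.pi / 3)) / (2 * (n : ℝ) + 1) ^ 2 := by
    refine tsum_congr fun n => ?_
    congr 1
    rw [show (2 * (n : ℝ) + 1) * (2 * (Real.pi / 3)) =
      Real.pi - (2 * n + 1) * (Real.pi / 3) + n * (2 * Real.pi) by ring, Real.sin_add_nat_mul_two_pi,
      Real.sin_pi_sub]
  have hneg : clausenTwo (2 * (2 * (Real.pi / 3))) = -clausenTwo (2 * (Real.pi / 3)) := by
    rw [clausenTwo, clausenTwo, ← tsum_neg]
    refine tsum_congr fun n => ?_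
    rw [← neg_div]
    congr 1
    rw [show ((n : ℝ) + 1) * (2 * (2 * (Real.pi / 3))) =
      -(((n : ℝ) + 1) * (2 * (Real.pi / 3))) + ((n + 1 : ℕ) : ℝ) * (2 * Real.pi) by push_cast; ring,
      Real.sin_add_nat_mul_two_pi, Real.sin_neg]
  rw [hodd, hneg] at h2
  rw [giesekingConstant, show Real.pi * (1 / 3) = Real.pi / 3 by ring]
  linarith

/-! ### The two series -/

/-- From n = (n - a) + a: the second part contributes a times the Γ limit together with (a/2) log M,
which raises the coefficient 1/4 - a/2 to 1/4. -/
theorem tendsto_alternating_sum_nat_mul_log_sub {a l : ℝ} (ha : a < 1)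
    (h : Tendsto (fun M : ℕ =>
      ∑ n ∈ Finset.Icc 1 (2 * M), (-1 : ℝ) ^ n * (((n : ℝ) - a) * Real.log ((n : ℝ) - a)) -
      (M : ℝ) * Real.log (2 * M) - (1 / 4 - a / 2) * Real.log M) atTop (𝓝 l)) :
    Tendsto (fun M : ℕ => ∑ n ∈ Finset.Icc 1 (2 * M),
        (-1 : ℝ) ^ n * ((n : ℝ) * Real.log ((n : ℝ) - a)) -
        (M : ℝ) * Real.log (2 * M) - Real.log M / 4) atTop
      (𝓝 (l + a * Real.log (Real.Gamma ((1 - a) / 2) / Real.Gamma (1 - a / 2)))) := by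
  refine (h.add ((tendsto_alternating_sum_log_sub ha).const_mul a)).congr fun M => ?_
  have e : ∑ n ∈ Finset.Icc 1 (2 * M), (-1 : ℝ) ^ n * ((n : ℝ) * Real.log ((n : ℝ) - a)) =
      ∑ n ∈ Finset.Icc 1 (2 * M), (-1 : ℝ) ^ n * (((n : ℝ) - a) * Real.log ((n : ℝ) - a)) +
      a * ∑ n ∈ Finset.Icc 1 (2 * M), (-1 : ℝ) ^ n * Real.log ((n : ℝ) - a) := by
    rw [Finset.mul_sum, ← Finset.sum_add_distrib]
    exact Finset.sum_congr rfl fun n _ => by ring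
  rw [e]
  ring

theorem tendsto_alternating_sum_halves :
    Tendsto (fun M : ℕ => ∑ n ∈ Finset.Icc 1 (2 * M),
        (-1 : ℝ) ^ n * (((n : ℝ) - 1 / 2) * Real.log ((n : ℝ) - 1 / 2)) -
        (M : ℝ) * Real.log (2 * M) - (1 / 4 - 1 / 2 / 2) * Real.log M) atTop
      (𝓝 (catalanConstant / Real.pi)) := by
  have h := (tendsto_alternating_sum_mul_log_add_reflection (a := 1 / 2) (by norm_num)
    le_rfl).div_const 2
  rw [integral_logCot (by norm_num) le_rfl, tsum_sin_odd_pi_half,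
    show 2 / Real.pi * catalanConstant / 2 = catalanConstant / Real.pi by ring] at h
  refine h.congr fun M => ?_
  rw [show (1 : ℝ) - 1 / 2 = 1 / 2 by norm_num]
  ring

theorem tendsto_alternating_sum_thirds :
    Tendsto (fun M : ℕ => ∑ n ∈ Finset.Icc 1 (2 * M),
        (-1 : ℝ) ^ n * (((n : ℝ) - 1 / 3) * Real.log ((n : ℝ) - 1 / 3)) -
        (M : ℝ) * Real.log (2 * M) - (1 / 4 - 1 / 3 / 2) * Real.log M) atTop
      (𝓝 (5 * giesekingConstant / (6 * Real.pi) + Real.log glaisherConstant - Real.log 3 / 24 -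
        Real.log 2 / 36)) := by
  -- T_{1/3} is half of (T_{1/3} + T_{2/3}) - (T_{2/3} - T_{1/3}).
  have h := ((tendsto_alternating_sum_mul_log_add_reflection (a := 1 / 3) (by norm_num)
    (by norm_num)).sub tendsto_alternating_sum_thirds_sub).div_const 2
  rw [integral_logCot (by norm_num) (by norm_num), tsum_sin_odd_pi_third,
    show (2 / Real.pi * (5 / 6 * giesekingConstant) -
      (Real.log 3 / 12 + Real.log 2 / 18 - 2 * Real.log glaisherConstant)) / 2 =
      5 * giesekingConstant / (6 * Real.pi) + Real.log glaisherConstant - Real.log 3 / 24 -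
        Real.log 2 / 36 by ring] at h
  refine h.congr fun M => ?_
  rw [show (1 : ℝ) - 1 / 3 = 2 / 3 by norm_num]
  ring

theorem mainTheorem8 :
    Filter.Tendsto
      (fun N : ℕ => ∑ n ∈ Finset.Icc 1 N, (-1 : ℝ) ^ n * (n : ℝ) *
        ((harmonic n : ℝ) - Real.log ((n : ℝ) - 1 / 2) - Real.eulerMascheroniConstant
          - 1 / (n : ℝ)))
      Filter.atTop
      (nhds ((Real.eulerMascheroniConstant + 1) / 4 - catalanConstant / Real.pi
        - 1 / 4 * Real.log (lemniscateConstant ^ 2 / Real.pi))) ∧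
    Filter.Tendsto
      (fun N : ℕ => ∑ n ∈ Finset.Icc 1 N, (-1 : ℝ) ^ n * (n : ℝ) *
        ((harmonic n : ℝ) - Real.log ((n : ℝ) - 1 / 3) - Real.eulerMascheroniConstant
          - 5 / (6 * (n : ℝ))))
      Filter.atTop
      (nhds ((Real.eulerMascheroniConstant + 1) / 4 - 5 * giesekingConstant / (6 * Real.pi)
        - Real.log glaisherConstant + 19 / 36 * Real.log 2 + Real.log 3 / 24
        + 1 / 3 * Real.log (Real.Gamma (5 / 6) / Real.Gamma (1 / 3)))) := by
  constructor
  · have h := tendsto_alternating_harmonic_sub_log (by norm_num)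
      (tendsto_alternating_sum_nat_mul_log_sub (by norm_num) tendsto_alternating_sum_halves)
    rw [show ((1 : ℝ) - 1 / 2) / 2 = 1 / 4 by norm_num,
      show (1 : ℝ) - 1 / 2 / 2 = 3 / 4 by norm_num] at h
    convert h using 2 with N
    · refine Finset.sum_congr rfl fun n _ => ?_
      rw [mul_assoc, show (1 / 2 + 1 / 2 : ℝ) = 1 by norm_num]
    · rw [log_lemniscateConstant_sq_div_pi]
      ring
  · have h := tendsto_alternating_harmonic_sub_log (by norm_num)
      (tendsto_alternating_sum_nat_mul_log_sub (by norm_num) tendsto_alternating_sum_thirds)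
    rw [show ((1 : ℝ) - 1 / 3) / 2 = 1 / 3 by norm_num,
      show (1 : ℝ) - 1 / 3 / 2 = 5 / 6 by norm_num] at h
    convert h using 2 with N
    · refine Finset.sum_congr rfl fun n _ => ?_
      rw [mul_assoc, show (1 / 2 + 1 / 3 : ℝ) = 5 / 6 by norm_num, div_div]
    · rw [← inv_div (Real.Gamma (1 / 3)) (Real.Gamma (5 / 6)), Real.log_inv]
      ring
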